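/- Let $K^d_n$ be the complete $d$-uniform hypergraph on $n$ vertices, whose hyperedges are all $d$-element subsets of the vertex set. If its vertices are placed at points of $\mathbb{R}^d$, a hyperedge is drawn as the convex hull of its $d$ vertices, and two hyperedges are said to cross if they are vertex disjoint and the relative interiors of their convex hulls have a common point. The $d$-dimensional moment curve is $\{(t,t^2,\ldots,t^d) : t\in\mathbb{R}\}$. There are absolute constants $c, C > 0$ such that for every integer $d\ge 2$, every integer $n \ge 0$, and every placement of the $n$ vertices of $K^d_n$ at $n$ distinct points of the $d$-dimensional moment curve, the number $N$ of (unordered) crossing pairs of hyperedges satisfies $$c\,\frac{4^d}{\sqrt d}\binom{n}{2d}\;\le\; N\;\le\; C\,\frac{4^d}{\sqrt d}\binom{n}{2d}.$$ -/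

import Mathlib

/-- The complete `d`-uniform hypergraph on the vertex type `V`:
its hyperedges are all the sets of exactly `d` vertices. -/
def completeUniformHypergraph (V : Type*) (d : ℕ) : Hypergraph V where
  vertexSet := Set.univ
  edgeSet := {e | e.encard = d}
  subset_vertexSet_of_mem_edgeSet' := fun _ _ => Set.subset_univ _

/-- The `d`-dimensional moment curve `{(t, t², …, t^d) : t ∈ ℝ}`. -/
def momentCurve (d : ℕ) : Set (EuclideanSpace ℝ (Fin d)) :=
  Set.range fun t : ℝ => WithLp.toLp 2 fun i : Fin d => t ^ ((i : ℕ) + 1)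

/-- The simplex representing the hyperedge `e` when each vertex `v` is placed at `p v`. -/
def hyperedgeSimplex {V : Type*} {d : ℕ} (p : V → EuclideanSpace ℝ (Fin d)) (e : Set V) :
    Set (EuclideanSpace ℝ (Fin d)) :=
  convexHull ℝ (p '' e)

/-- Two hyperedges cross, in the placement `p` of the vertices, if they are vertex disjoint and
the relative interiors of their simplices have a common point. -/
def HyperedgesCross {V : Type*} {d : ℕ} (p : V → EuclideanSpace ℝ (Fin d)) (e f : Set V) : Prop :=
  Disjoint e f ∧
    (intrinsicInterior ℝ (hyperedgeSimplex p e) ∩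
      intrinsicInterior ℝ (hyperedgeSimplex p f)).Nonempty

/-- The set of (unordered) crossing pairs of hyperedges of `H` in the placement `p`. -/
def crossingPairs {V : Type*} {d : ℕ} (H : Hypergraph V) (p : V → EuclideanSpace ℝ (Fin d)) :
    Set (Sym2 (Set V)) :=
  {s | ∃ e ∈ H.edgeSet, ∃ f ∈ H.edgeSet, HyperedgesCross p e f ∧ s = s(e, f)}

/-!
The upper bound is a crude count: a pair of disjoint `d`-sets is determined by its union and one of
the two sets, so there are at most `(n.choose (2 * d)) * d.centralBinom` pairs, and
`d.centralBinom ≤ 4 ^ d / √d`.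

For the lower bound, sort `2 * d` of the vertices by their parameter `t` and record a partition of
them into two hyperedges as a word of length `2 * d` over `Bool`. The two simplices cross as soon as
this word has at least `d + 1` letter changes. Indeed the weights
`R (t i) / ∏ j ≠ i, (t i - t j)` annihilate all polynomials of degree at most `d` if `R` has degree
at most `d - 2`; without `R` their signs alternate, and letting `R` change its sign exactly in the
at most `d - 2` gaps where the word does not change makes their signs agree with the word
(`exists_pos_weights_sum_eval_eq`). Normalised, the positive and the negative weights describe one
point as a convex combination, with positive weights, of the vertices of either simplex, hence a
common point of the two relative interiors (`sum_smul_mem_intrinsicInterior_convexHull`).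

It remains to see that a fixed proportion of the words qualifies. There are
`((d - 1).choose j) ^ 2` balanced words that start with `true` and have `2 * j + 1` changes
(`card_signWords`). By the symmetry of these numbers and a comparison of the middle one with its
neighbour, those with `d ≤ 2 * j` make up at least a sixth of the total `(d - 1).centralBinom`
(`centralBinom_le_six_mul_sum_choose_sq`), which has the order of `4 ^ d / √d`.
-/

/-! ### Estimates for binomial coefficients -/

theorem sixteen_pow_le_four_mul_centralBinom_sq {n : ℕ} (hn : 1 ≤ n) :
    16 ^ n ≤ 4 * n * n.centralBinom ^ 2 := by
  induction n, hn using Nat.le_induction with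
  | base => decide
  | succ n hn ih =>
    have h := Nat.succ_mul_centralBinom_succ n
    have hpos : 0 < n + 1 := by omega
    refine le_of_mul_le_mul_left ?_ hpos
    calc (n + 1) * 16 ^ (n + 1) = 16 * (n + 1) * 16 ^ n := by ring
      _ ≤ 16 * (n + 1) * (4 * n * n.centralBinom ^ 2) := Nat.mul_le_mul_left _ ih
      _ = (16 * (4 * n * (n + 1))) * n.centralBinom ^ 2 := by ring
      _ ≤ (16 * (2 * n + 1) ^ 2) * n.centralBinom ^ 2 := by
          refine Nat.mul_le_mul_right _ (Nat.mul_le_mul_left _ ?_)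
          nlinarith
      _ = 4 * (2 * (2 * n + 1) * n.centralBinom) ^ 2 := by ring
      _ = 4 * ((n + 1) * (n + 1).centralBinom) ^ 2 := by rw [h]
      _ = (n + 1) * (4 * (n + 1) * (n + 1).centralBinom ^ 2) := by ring

theorem two_mul_add_one_mul_centralBinom_sq_le (n : ℕ) :
    (2 * n + 1) * n.centralBinom ^ 2 ≤ 16 ^ n := by
  induction n with
  | zero => simp
  | succ n ih =>
    have h := Nat.succ_mul_centralBinom_succ n
    have hpos : 0 < (n + 1) ^ 2 := by positivity
    refine le_of_mul_le_mul_left ?_ hpos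
    calc (n + 1) ^ 2 * ((2 * (n + 1) + 1) * (n + 1).centralBinom ^ 2)
        = (2 * n + 3) * ((n + 1) * (n + 1).centralBinom) ^ 2 := by ring
      _ = (2 * n + 3) * (2 * (2 * n + 1) * n.centralBinom) ^ 2 := by rw [h]
      _ = (4 * ((2 * n + 3) * (2 * n + 1))) * ((2 * n + 1) * n.centralBinom ^ 2) := by ring
      _ ≤ (16 * (n + 1) ^ 2) * 16 ^ n := Nat.mul_le_mul (by nlinarith) ih
      _ = (n + 1) ^ 2 * 16 ^ (n + 1) := by ring

theorem centralBinom_le_four_pow_div_sqrt {d : ℕ} (hd : 1 ≤ d) :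
    (d.centralBinom : ℝ) ≤ 4 ^ d / √(d : ℝ) := by
  have hd' : (0 : ℝ) < d := by exact_mod_cast hd
  rw [le_div_iff₀ (Real.sqrt_pos.2 hd')]
  refine (sq_le_sq₀ (by positivity) (by positivity)).1 ?_
  rw [mul_pow, Real.sq_sqrt hd'.le, ← pow_mul, mul_comm d 2, pow_mul]
  have h : ((2 * d + 1) * d.centralBinom ^ 2 : ℝ) ≤ 16 ^ d := by
    exact_mod_cast two_mul_add_one_mul_centralBinom_sq_le d
  norm_num
  nlinarith [sq_nonneg (d.centralBinom : ℝ)]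

theorem four_pow_div_sqrt_le_centralBinom {m : ℕ} (hm : 1 ≤ m) :
    (4 : ℝ) ^ (m + 1) / √((m + 1 : ℕ) : ℝ) ≤ 8 * m.centralBinom := by
  have hm' : (0 : ℝ) < m := by exact_mod_cast hm
  have hm1 : (0 : ℝ) < ((m + 1 : ℕ) : ℝ) := by positivity
  rw [div_le_iff₀ (Real.sqrt_pos.2 hm1)]
  refine (sq_le_sq₀ (by positivity) (by positivity)).1 ?_
  rw [mul_pow, Real.sq_sqrt hm1.le, ← pow_mul, mul_comm (m + 1) 2, pow_mul]
  have h : (16 ^ m : ℝ) ≤ 4 * m * m.centralBinom ^ 2 := by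
    exact_mod_cast sixteen_pow_le_four_mul_centralBinom_sq hm
  push_cast
  norm_num [pow_succ (16 : ℝ) m]
  nlinarith [sq_nonneg (m.centralBinom : ℝ)]

/-- The terms of `∑ j, (m.choose j) ^ 2 = m.centralBinom` beyond the middle carry a fixed
proportion of the sum: the two halves agree by symmetry, and the middle term, if there is one,
is at most four times its neighbour. -/
theorem centralBinom_le_six_mul_sum_choose_sq {m : ℕ} (hm : 1 ≤ m) :
    m.centralBinom ≤ 6 * ∑ j ∈ Finset.range (m + 1) with m < 2 * j, m.choose j ^ 2 := by
  set U := ∑ j ∈ Finset.range (m + 1) with m < 2 * j, m.choose j ^ 2 with hU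
  have htot : m.centralBinom = ∑ j ∈ Finset.range (m + 1), m.choose j ^ 2 := by
    rw [Nat.sum_range_choose_sq, Nat.centralBinom_eq_two_mul_choose]
  have hsplit := Finset.sum_filter_add_sum_filter_not (Finset.range (m + 1))
    (fun j => m < 2 * j) (fun j => m.choose j ^ 2)
  have hrefl : ∑ j ∈ Finset.range (m + 1) with ¬ m < 2 * j, m.choose j ^ 2
      = ∑ j ∈ Finset.range (m + 1) with m ≤ 2 * j, m.choose j ^ 2 := by
    refine Finset.sum_bij' (fun j _ => m - j) (fun j _ => m - j) ?_ ?_ ?_ ?_ ?_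
    · intro j hj
      simp only [Finset.mem_filter, Finset.mem_range] at hj ⊢
      omega
    · intro j hj
      simp only [Finset.mem_filter, Finset.mem_range] at hj ⊢
      omega
    · intro j hj
      simp only [Finset.mem_filter, Finset.mem_range] at hj
      omega
    · intro j hj
      simp only [Finset.mem_filter, Finset.mem_range] at hj
      omega
    · intro j hj
      simp only [Finset.mem_filter, Finset.mem_range] at hj
      rw [Nat.choose_symm (by omega)]
  have hle : ∑ j ∈ Finset.range (m + 1) with m ≤ 2 * j, m.choose j ^ 2 ≤ 5 * U := by
    rcases Nat.even_or_odd' m with ⟨k, rfl | rfl⟩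
    · have hset : (Finset.range (2 * k + 1)).filter (fun j => 2 * k ≤ 2 * j)
          = insert k ((Finset.range (2 * k + 1)).filter (fun j => 2 * k < 2 * j)) := by
        ext j
        simp only [Finset.mem_filter, Finset.mem_range, Finset.mem_insert]
        omega
      rw [hset, Finset.sum_insert (by simp)]
      have hmid : (2 * k).choose k ≤ 2 * (2 * k).choose (k + 1) := by
        have h := Nat.choose_succ_right_eq (2 * k) k
        rw [show 2 * k - k = k by omega] at h
        refine le_of_mul_le_mul_left ?_ (show 0 < k by omega)
        have : (2 * k).choose (k + 1) * (k + 1) ≤ (2 * k).choose (k + 1) * (2 * k) :=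
          Nat.mul_le_mul_left _ (by omega)
        linarith
      have hone : (2 * k).choose (k + 1) ^ 2 ≤ U := by
        refine Finset.single_le_sum (f := fun j => (2 * k).choose j ^ 2)
          (fun _ _ => Nat.zero_le _) ?_
        simp only [Finset.mem_filter, Finset.mem_range]
        omega
      have := Nat.pow_le_pow_left hmid 2
      rw [mul_pow] at this
      linarith
    · have hset : (Finset.range (2 * k + 1 + 1)).filter (fun j => 2 * k + 1 ≤ 2 * j)
          = (Finset.range (2 * k + 1 + 1)).filter (fun j => 2 * k + 1 < 2 * j) := by
        ext j
        simp only [Finset.mem_filter, Finset.mem_range]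
        omega
      rw [hset]
      linarith [Nat.zero_le U]
  rw [htot, ← hsplit, hrefl]
  linarith

/-! ### Sign words with a prescribed number of sign changes -/

/-- The nonempty words over `Bool` that start with the letter `b`, contain `a` further letters `b`
and `c` letters `!b`, and have exactly `k` places where consecutive letters differ. -/
def signWords (b : Bool) : ℕ → ℕ → ℕ → Finset (List Bool)
  | 0, 0, 0 => {[b]}
  | 0, 0, _ + 1 => ∅
  | a + 1, 0, k => (signWords b a 0 k).image (List.cons b)
  | _, _ + 1, 0 => ∅
  | 0, c + 1, k + 1 => (signWords (!b) c 0 k).image (List.cons b)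
  | a + 1, c + 1, k + 1 =>
      (signWords b a (c + 1) (k + 1)).image (List.cons b) ∪
        (signWords (!b) c (a + 1) k).image (List.cons b)
termination_by a c => a + c

/-- The places `i` at which the word `l` has the same letter in the positions `i` and `i + 1`. -/
def agreements (l : List Bool) : Finset ℕ :=
  (Finset.range (l.length - 1)).filter fun i => l.getD i false = l.getD (i + 1) false

theorem card_agreements_cons_cons (b b' : Bool) (l : List Bool) :
    (agreements (b :: b' :: l)).card
      = (agreements (b' :: l)).card + if b = b' then 1 else 0 := by
  simp only [agreements, Finset.card_filter, List.length_cons, Nat.add_sub_cancel]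
  rw [Finset.sum_range_succ']
  simp

theorem card_filter_getD_eq_count (l : List Bool) (b : Bool) :
    ((Finset.range l.length).filter fun i => l.getD i false = b).card = l.count b := by
  induction l with
  | nil => simp
  | cons x l ih =>
    rw [Finset.card_filter, List.length_cons, Finset.sum_range_succ', List.count_cons, ← ih,
      Finset.card_filter]
    simp

theorem signWords_spec (n : ℕ) : ∀ (b : Bool) (a c k : ℕ), a + c = n → ∀ l ∈ signWords b a c k,
    (∃ t, l = b :: t) ∧ l.count b = a + 1 ∧ l.count (!b) = c ∧
      (agreements l).card + k = a + c := by
  induction n with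
  | zero =>
    intro b a c k h l hl
    obtain ⟨rfl, rfl⟩ : a = 0 ∧ c = 0 := by omega
    cases k with
    | zero =>
      rw [signWords, Finset.mem_singleton] at hl
      subst hl
      simp [agreements]
    | succ k => simp [signWords] at hl
  | succ n ih =>
    -- The two ways in which a word of the recursion arises: by repeating or by changing the letter.
    have hsame : ∀ (b : Bool) (a c k : ℕ), a + c = n → ∀ l ∈ signWords b a c k,
        (∃ t, b :: l = b :: t) ∧ (b :: l).count b = a + 1 + 1 ∧ (b :: l).count (!b) = c ∧
          (agreements (b :: l)).card + k = a + 1 + c := by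
      intro b a c k h l hl
      obtain ⟨⟨t, rfl⟩, h1, h2, h3⟩ := ih b a c k h l hl
      refine ⟨⟨_, rfl⟩, ?_, ?_, ?_⟩
      · rw [List.count_cons_self, h1]
      · rw [List.count_cons_of_ne (by simp), h2]
      · rw [card_agreements_cons_cons, if_pos rfl]
        omega
    have hdiff : ∀ (b : Bool) (a c k : ℕ), a + c = n → ∀ l ∈ signWords (!b) c a k,
        (∃ t, b :: l = b :: t) ∧ (b :: l).count b = a + 1 ∧ (b :: l).count (!b) = c + 1 ∧
          (agreements (b :: l)).card + (k + 1) = a + (c + 1) := by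
      intro b a c k h l hl
      obtain ⟨⟨t, rfl⟩, h1, h2, h3⟩ := ih (!b) c a k (by omega) l hl
      rw [Bool.not_not] at h2
      refine ⟨⟨_, rfl⟩, ?_, ?_, ?_⟩
      · rw [List.count_cons_self, h2]
      · rw [List.count_cons_of_ne (by simp), h1]
      · rw [card_agreements_cons_cons, if_neg (by simp)]
        omega
    intro b a c k h l hl
    match a, c, k, h, hl with
    | a + 1, 0, k, h, hl =>
      rw [signWords, Finset.mem_image] at hl
      obtain ⟨l', hl', rfl⟩ := hl
      exact hsame b a 0 k (by omega) l' hl'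
    | a, c + 1, 0, h, hl =>
      simp [signWords] at hl
    | 0, c + 1, k + 1, h, hl =>
      rw [signWords, Finset.mem_image] at hl
      obtain ⟨l', hl', rfl⟩ := hl
      exact hdiff b 0 c k (by omega) l' hl'
    | a + 1, c + 1, k + 1, h, hl =>
      rw [signWords, Finset.mem_union, Finset.mem_image, Finset.mem_image] at hl
      rcases hl with ⟨l', hl', rfl⟩ | ⟨l', hl', rfl⟩
      · exact hsame b a (c + 1) (k + 1) (by omega) l' hl'
      · exact hdiff b (a + 1) c k (by omega) l' hl'

theorem card_signWords_zero_right (b : Bool) (a k : ℕ) :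
    (signWords b a 0 k).card = if k = 0 then 1 else 0 := by
  induction a with
  | zero => cases k <;> simp [signWords]
  | succ a ih =>
    rw [signWords, Finset.card_image_of_injective _ List.cons_injective, ih]

theorem card_signWords_succ_succ_succ (b : Bool) (a c k : ℕ) :
    (signWords b (a + 1) (c + 1) (k + 1)).card
      = (signWords b a (c + 1) (k + 1)).card + (signWords (!b) c (a + 1) k).card := by
  rw [signWords, Finset.card_union_of_disjoint,
    Finset.card_image_of_injective _ List.cons_injective,
    Finset.card_image_of_injective _ List.cons_injective]
  -- The words of the two families differ in their second letter.
  rw [Finset.disjoint_left]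
  intro l h1 h2
  obtain ⟨l₁, hl₁, rfl⟩ := Finset.mem_image.1 h1
  obtain ⟨l₂, hl₂, h⟩ := Finset.mem_image.1 h2
  obtain ⟨⟨t₁, rfl⟩, -⟩ := signWords_spec _ b a (c + 1) (k + 1) rfl l₁ hl₁
  obtain ⟨⟨t₂, rfl⟩, -⟩ := signWords_spec _ (!b) c (a + 1) k rfl l₂ hl₂
  simp at h

/-- A word with `k` sign changes splits into `k + 1` blocks, so it amounts to a pair of
compositions, one of each letter count; Pascal's rule turns the recursion into this count. -/
theorem card_signWords (n : ℕ) : ∀ (b : Bool) (a c : ℕ), a + c = n → ∀ j,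
    (signWords b a (c + 1) (2 * j + 1)).card = a.choose j * c.choose j ∧
      (signWords b a (c + 1) (2 * j + 2)).card = a.choose (j + 1) * c.choose j := by
  induction n with
  | zero =>
    intro b a c h j
    obtain ⟨rfl, rfl⟩ : a = 0 ∧ c = 0 := by omega
    simp only [signWords, Finset.card_image_of_injective _ List.cons_injective,
      card_signWords_zero_right]
    cases j <;> simp
  | succ n ih =>
    intro b a c h j
    cases a with
    | zero =>
      simp only [signWords, Finset.card_image_of_injective _ List.cons_injective,
        card_signWords_zero_right]
      cases j <;> simp
    | succ a =>
      rw [card_signWords_succ_succ_succ, card_signWords_succ_succ_succ,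
        (ih b a c (by omega) j).1, (ih b a c (by omega) j).2, (ih (!b) c a (by omega) j).1]
      refine ⟨?_, by rw [Nat.choose_succ_succ]; ring⟩
      cases j with
      | zero => simp [signWords]
      | succ j =>
        rw [show 2 * (j + 1) = 2 * j + 2 by ring, (ih (!b) c a (by omega) j).2,
          Nat.choose_succ_succ a j]
        ring

/-- The words with `m + 1` letters of each kind that start with `true` and have so many sign
changes that at most `m - 1` of the `2 * m + 1` pairs of consecutive letters agree. -/
def manyChangeWords (m : ℕ) : Finset (List Bool) :=
  ((Finset.range (m + 1)).filter fun j => m < 2 * j).biUnion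
    fun j => signWords true m (m + 1) (2 * j + 1)

theorem card_manyChangeWords (m : ℕ) :
    (manyChangeWords m).card = ∑ j ∈ Finset.range (m + 1) with m < 2 * j, m.choose j ^ 2 := by
  rw [manyChangeWords, Finset.card_biUnion]
  · exact Finset.sum_congr rfl fun j _ => by
      rw [(card_signWords _ true m m rfl j).1, sq]
  · intro i _ j _ hij
    simp only [Function.onFun]
    rw [Finset.disjoint_left]
    intro l h1 h2
    have h3 := (signWords_spec _ true m (m + 1) _ rfl l h1).2.2.2
    have h4 := (signWords_spec _ true m (m + 1) _ rfl l h2).2.2.2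
    omega

theorem manyChangeWords_spec {m : ℕ} {l : List Bool} (hl : l ∈ manyChangeWords m) :
    (∃ t, l = true :: t) ∧ l.length = 2 * (m + 1) ∧ (∀ b, l.count b = m + 1) ∧
      (agreements l).card + 1 ≤ m := by
  simp only [manyChangeWords, Finset.mem_biUnion, Finset.mem_filter, Finset.mem_range] at hl
  obtain ⟨j, hj, hl⟩ := hl
  obtain ⟨h1, h2, h3, h4⟩ := signWords_spec _ true m (m + 1) _ rfl l hl
  rw [Bool.not_true] at h3
  refine ⟨h1, ?_, Bool.rec h3 h2, by omega⟩
  rw [← List.count_true_add_count_false, h2, h3]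
  ring

/-! ### Relative interiors of convex hulls -/

theorem Convex.combo_mem_intrinsicInterior {E : Type*} [NormedAddCommGroup E] [NormedSpace ℝ E]
    {s : Set E} (hs : Convex ℝ s) {y z : E} (hy : y ∈ intrinsicInterior ℝ s) (hz : z ∈ s)
    {ε : ℝ} (h0 : 0 < ε) (h1 : ε ≤ 1) : ε • y + (1 - ε) • z ∈ intrinsicInterior ℝ s := by
  obtain ⟨⟨y, hyA⟩, hy, rfl⟩ := hy
  rw [mem_interior_iff_mem_nhds, Metric.mem_nhds_iff] at hy
  obtain ⟨δ, hδ, hball⟩ := hy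
  have hys : y ∈ s := hball (Metric.mem_ball_self hδ)
  have hx : ε • y + (1 - ε) • z ∈ s := hs hys hz h0.le (by linarith) (by ring)
  refine mem_intrinsicInterior.2 ⟨⟨_, subset_affineSpan ℝ s hx⟩, ?_, rfl⟩
  rw [mem_interior_iff_mem_nhds, Metric.mem_nhds_iff]
  refine ⟨ε * δ, by positivity, ?_⟩
  rintro ⟨u, huA⟩ hu
  -- A point `u` close to `ε • y + (1 - ε) • z` is the same combination of a point near `y` and `z`.
  have hy' := AffineSubspace.smul_vsub_vadd_mem (affineSpan ℝ s) ε⁻¹ huA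
    (subset_affineSpan ℝ s hx) hyA
  simp only [vsub_eq_sub, vadd_eq_add] at hy'
  set y' := ε⁻¹ • (u - (ε • y + (1 - ε) • z)) + y with hy'def
  have hy's : y' ∈ s := by
    refine hball (show (⟨y', hy'⟩ : affineSpan ℝ s) ∈ Metric.ball _ δ from ?_)
    rw [Metric.mem_ball, Subtype.dist_eq, dist_eq_norm] at hu ⊢
    simp only [hy'def, add_sub_cancel_right, norm_smul, norm_inv, Real.norm_eq_abs,
      abs_of_pos h0]
    rwa [inv_mul_lt_iff₀ h0]
  have hu' : u = ε • y' + (1 - ε) • z := by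
    rw [hy'def, smul_add, smul_inv_smul₀ h0.ne']
    abel
  change u ∈ s
  rw [hu']
  exact hs hy's hz h0.le (by linarith) (by ring)

/-- A convex combination with positive weights of all the points of a finite set lies in the
relative interior of their convex hull. -/
theorem sum_smul_mem_intrinsicInterior_convexHull {ι E : Type*} [NormedAddCommGroup E]
    [NormedSpace ℝ E] [FiniteDimensional ℝ E] (J : Finset ι) (f : ι → E) (w : ι → ℝ)
    (hf : Set.InjOn f J) (hw : ∀ i ∈ J, 0 < w i) (hsum : ∑ i ∈ J, w i = 1) :
    ∑ i ∈ J, w i • f i ∈ intrinsicInterior ℝ (convexHull ℝ (f '' (J : Set ι))) := by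
  have hJ : J.Nonempty := by
    by_contra h
    rw [Finset.not_nonempty_iff_eq_empty] at h
    simp [h] at hsum
  obtain ⟨y, hy⟩ := Set.Nonempty.intrinsicInterior (convex_convexHull ℝ (f '' (J : Set ι)))
    ((convexHull_nonempty_iff).2 ((Finset.coe_nonempty.2 hJ).image f))
  obtain ⟨u, hu0, hu1, huy⟩ : ∃ u : ι → ℝ, (∀ i ∈ J, 0 ≤ u i) ∧ ∑ i ∈ J, u i = 1 ∧
      ∑ i ∈ J, u i • f i = y := by
    classical
    have hyc := intrinsicInterior_subset hy
    rw [← Finset.coe_image, Finset.mem_convexHull'] at hyc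
    obtain ⟨u, hu0, hu1, huy⟩ := hyc
    rw [Finset.sum_image hf] at hu1 huy
    exact ⟨u ∘ f, fun i hi => hu0 _ (Finset.mem_image_of_mem f hi), hu1, huy⟩
  obtain ⟨i₀, hi₀, hmin⟩ := J.exists_min_image w hJ
  have hε := hw i₀ hi₀
  -- Half of the least weight, so that `ε • y` can be split off with nonnegative weights left and
  -- `ε < 1` also if there is only one point.
  set ε := w i₀ / 2 with hεdef
  have hw1 : w i₀ ≤ 1 := hsum ▸ Finset.single_le_sum (fun i hi => (hw i hi).le) hi₀
  have hε0 : 0 < ε := by positivity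
  have hε1 : 0 < 1 - ε := by linarith
  have hz : ∑ i ∈ J, ((1 - ε)⁻¹ * (w i - ε * u i)) • f i ∈ convexHull ℝ (f '' (J : Set ι)) := by
    refine (convex_convexHull ℝ _).sum_mem ?_ ?_ ?_
    · intro i hi
      have h1 : u i ≤ 1 := hu1 ▸ Finset.single_le_sum hu0 hi
      have h2 := hmin i hi
      have : 0 ≤ w i - ε * u i := by nlinarith [hu0 i hi]
      positivity
    · rw [← Finset.mul_sum, Finset.sum_sub_distrib, ← Finset.mul_sum, hsum, hu1, mul_one,
        inv_mul_cancel₀ hε1.ne']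
    · intro i hi
      exact subset_convexHull ℝ _ ⟨i, hi, rfl⟩
  have := (convex_convexHull ℝ (f '' (J : Set ι))).combo_mem_intrinsicInterior hy hz hε0
    (by linarith)
  convert this using 1
  rw [← huy, Finset.smul_sum, Finset.smul_sum, ← Finset.sum_add_distrib]
  refine Finset.sum_congr rfl fun i _ => ?_
  rw [smul_smul, smul_smul, ← add_smul, mul_inv_cancel_left₀ hε1.ne']
  congr 1
  ring

/-! ### Positive dependences between points of the moment curve -/

open Polynomial in
/-- Gale duality for the moment curve. The weights `R (s i) / ∏ j ≠ i, (s i - s j)` annihilate all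
polynomials of degree less than `m - 1 - deg R`. Without the factor `R (s i)` their signs alternate;
taking for `R` a polynomial that changes its sign exactly in the gaps where `σ` has no sign change
makes the signs of the weights equal to `σ`, up to a common sign. -/
theorem exists_pos_weights_sum_eval_eq {m : ℕ} (hm : 2 ≤ m) {s : ℕ → ℝ}
    (hs : ∀ i j, i < j → j < m → s i < s j) (σ : ℕ → Bool) :
    ∃ w : ℕ → ℝ, (∀ i < m, 0 < w i) ∧ ∀ P : ℝ[X],
      P.natDegree + ((Finset.range (m - 1)).filter fun i => σ i = σ (i + 1)).card + 1 < m →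
      ∑ i ∈ Finset.range m with σ i = true, w i * P.eval (s i)
        = ∑ i ∈ Finset.range m with σ i = false, w i * P.eval (s i) := by
  set G := (Finset.range (m - 1)).filter fun i => σ i = σ (i + 1) with hG
  have hGlt : ∀ g ∈ G, g + 1 < m := by
    intro g hg
    simp only [hG, Finset.mem_filter, Finset.mem_range] at hg
    omega
  have hle : ∀ i j, i ≤ j → j < m → s i ≤ s j := by
    intro i j hij hj
    rcases hij.eq_or_lt with rfl | h
    · exact le_rfl
    · exact (hs i j h hj).le
  have hinj : Set.InjOn s (Finset.range m) := by
    intro i hi j hj hij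
    simp only [Finset.coe_range, Set.mem_Iio] at hi hj
    rcases lt_trichotomy i j with h | h | h
    · exact absurd hij (hs i j h hj).ne
    · exact h
    · exact absurd hij (hs j i h hi).ne'
  set R : ℝ[X] := ∏ g ∈ G, (X - C ((s g + s (g + 1)) / 2)) with hR
  have hRdeg : R.natDegree = G.card := by
    rw [hR, natDegree_prod_of_monic _ _ fun g _ => monic_X_sub_C _]
    simp
  have hReval : ∀ x, R.eval x = ∏ g ∈ G, (x - (s g + s (g + 1)) / 2) := by
    intro x
    simp [hR, eval_prod]
  set D : ℕ → ℝ := fun i => ∏ j ∈ (Finset.range m).erase i, (s i - s j) with hD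
  set v : ℕ → ℝ := fun i => R.eval (s i) / D i with hv
  set e : ℕ → ℝ := fun i => if σ i = true then 1 else -1 with he
  have hee : ∀ i, e i * e i = 1 := by
    intro i
    simp only [he]
    split_ifs <;> norm_num
  have hDD : ∀ i, i + 1 < m → D i * D (i + 1) < 0 := by
    intro i hi
    have h1 : D i = (s i - s (i + 1)) *
        ∏ j ∈ ((Finset.range m).erase i).erase (i + 1), (s i - s j) :=
      (Finset.mul_prod_erase _ _ (by simp [hi])).symm
    have h2 : D (i + 1) = (s (i + 1) - s i) *
        ∏ j ∈ ((Finset.range m).erase i).erase (i + 1), (s (i + 1) - s j) := by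
      rw [Finset.erase_right_comm]
      exact (Finset.mul_prod_erase _ (fun j => s (i + 1) - s j)
        (by simp only [Finset.mem_erase, Finset.mem_range]; omega)).symm
    have h3 : 0 < ∏ j ∈ ((Finset.range m).erase i).erase (i + 1),
        ((s i - s j) * (s (i + 1) - s j)) := by
      refine Finset.prod_pos fun j hj => ?_
      simp only [Finset.mem_erase, Finset.mem_range] at hj
      rcases lt_or_gt_of_ne hj.2.1 with h | h
      · exact mul_pos (sub_pos.2 (hs j i h (by omega))) (sub_pos.2 (hs j (i + 1) (by omega) hi))
      · exact mul_pos_of_neg_of_neg (sub_neg.2 (hs i j h hj.2.2))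
          (sub_neg.2 (hs (i + 1) j (by omega) hj.2.2))
    have h4 := hs i (i + 1) (by omega) hi
    rw [Finset.prod_mul_distrib] at h3
    rw [h1, h2]
    nlinarith [mul_pos (mul_pos (sub_pos.2 h4) (sub_pos.2 h4)) h3]
  have hRfac : ∀ i, i + 1 < m → ∀ g ∈ G, g ≠ i →
      0 < (s i - (s g + s (g + 1)) / 2) * (s (i + 1) - (s g + s (g + 1)) / 2) := by
    intro i hi g hg hgi
    have hgm := hGlt g hg
    have h1 := hs g (g + 1) (by omega) hgm
    have h2 := hs i (i + 1) (by omega) hi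
    rcases lt_or_gt_of_ne hgi with h | h
    · have h3 := hle (g + 1) i h (by omega)
      exact mul_pos (by linarith) (by linarith)
    · have h3 := hle (i + 1) g h (by omega)
      exact mul_pos_of_neg_of_neg (by linarith) (by linarith)
  have hRR : ∀ i, i + 1 < m → R.eval (s i) * R.eval (s (i + 1)) * (e i * e (i + 1)) < 0 := by
    intro i hi
    rw [hReval, hReval, ← Finset.prod_mul_distrib]
    by_cases hiG : i ∈ G
    · rw [← Finset.mul_prod_erase G _ hiG]
      have h1 : 0 < ∏ g ∈ G.erase i,
          ((s i - (s g + s (g + 1)) / 2) * (s (i + 1) - (s g + s (g + 1)) / 2)) :=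
        Finset.prod_pos fun g hg =>
          hRfac i hi g (Finset.mem_of_mem_erase hg) (Finset.ne_of_mem_erase hg)
      have h2 : e i * e (i + 1) = 1 := by
        have : σ i = σ (i + 1) := (Finset.mem_filter.1 hiG).2
        rw [← hee i]
        simp only [he, this]
      have h3 := hs i (i + 1) (by omega) hi
      rw [h2, mul_one]
      exact mul_neg_of_neg_of_pos
        (mul_neg_of_neg_of_pos (by linarith) (by linarith)) h1
    · have h1 : 0 < ∏ g ∈ G,
          ((s i - (s g + s (g + 1)) / 2) * (s (i + 1) - (s g + s (g + 1)) / 2)) :=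
        Finset.prod_pos fun g hg => hRfac i hi g hg (fun h => hiG (h ▸ hg))
      have h2 : e i * e (i + 1) = -1 := by
        have : σ i ≠ σ (i + 1) := fun h =>
          hiG (Finset.mem_filter.2 ⟨Finset.mem_range.2 (by omega), h⟩)
        simp only [he]
        cases h : σ i <;> cases h' : σ (i + 1) <;> simp_all
      rw [h2]
      linarith
  have hstep : ∀ i, i + 1 < m → 0 < (e i * v i) * (e (i + 1) * v (i + 1)) := by
    intro i hi
    have : (e i * v i) * (e (i + 1) * v (i + 1))
        = (R.eval (s i) * R.eval (s (i + 1)) * (e i * e (i + 1))) / (D i * D (i + 1)) := by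
      simp only [hv]
      rw [div_eq_mul_inv, div_eq_mul_inv, div_eq_mul_inv, mul_inv]
      ring
    rw [this]
    exact div_pos_of_neg_of_neg (hRR i hi) (hDD i hi)
  have hpos : ∀ i < m, 0 < (e 0 * v 0) * (e i * v i) := by
    intro i hi
    induction i with
    | zero =>
      have := (hstep 0 (by omega)).ne'
      have h0 : e 0 * v 0 ≠ 0 := left_ne_zero_of_mul this
      exact mul_self_pos.2 h0
    | succ i ih =>
      have h1 := ih (by omega)
      have h2 := hstep i hi
      have h3 := mul_pos h1 h2
      have h4 : 0 < (e i * v i) * (e i * v i) := mul_self_pos.2 (left_ne_zero_of_mul h2.ne')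
      exact pos_of_mul_pos_left (b := (e i * v i) * (e i * v i))
        (by nlinarith) h4.le
  refine ⟨fun i => (e 0 * v 0) * (e i * v i), hpos, fun P hP => ?_⟩
  have hzero : ∑ i ∈ Finset.range m, v i * P.eval (s i) = 0 := by
    have hdeg : (R * P).natDegree < m - 1 := by
      refine lt_of_le_of_lt natDegree_mul_le ?_
      rw [hRdeg]
      omega
    have hcoeff := Lagrange.coeff_eq_sum hinj (P := R * P) (by
      rw [Finset.card_range]
      exact lt_of_le_of_lt degree_le_natDegree (by exact_mod_cast (by omega)))
    rw [Finset.card_range, coeff_eq_zero_of_natDegree_lt hdeg] at hcoeff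
    rw [hcoeff]
    refine Finset.sum_congr rfl fun i _ => ?_
    rw [eval_mul]
    simp only [hv, hD]
    ring
  rw [← sub_eq_zero]
  have hfalse : (Finset.range m).filter (fun i => σ i = false)
      = (Finset.range m).filter (fun i => ¬ σ i = true) := by simp
  calc _ = ∑ i ∈ Finset.range m with σ i = true, e 0 * v 0 * (v i * P.eval (s i))
        + ∑ i ∈ Finset.range m with ¬ σ i = true, e 0 * v 0 * (v i * P.eval (s i)) := by
        rw [hfalse, sub_eq_add_neg, ← Finset.sum_neg_distrib]
        congr 1
        · refine Finset.sum_congr rfl fun i hi => ?_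
          have : e i = 1 := if_pos (Finset.mem_filter.1 hi).2
          simp only [this]
          ring
        · refine Finset.sum_congr rfl fun i hi => ?_
          have : e i = -1 := if_neg (Finset.mem_filter.1 hi).2
          simp only [this]
          ring
    _ = 0 := by
        rw [Finset.sum_filter_add_sum_filter_not, ← Finset.mul_sum, hzero, mul_zero]

/-! ### Crossing pairs of simplices with vertices on the moment curve -/

/-- Two simplices spanned by `2 * d` points of the moment curve cross if the word recording which
of the two simplices each point belongs to, in the order along the curve, has at most `d - 2`
agreements, that is, at least `d + 1` changes. -/
theorem hyperedgesCross_of_card_agreements_le {V : Type*} {d : ℕ} {t : V → ℝ}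
    {p : V → EuclideanSpace ℝ (Fin d)}
    (hp : ∀ v, p v = WithLp.toLp 2 fun i : Fin d => t v ^ ((i : ℕ) + 1))
    (hinj : Function.Injective p) {u : ℕ → V}
    (hu : ∀ i j, i < j → j < 2 * d → t (u i) < t (u j)) {σ : ℕ → Bool}
    (hσ : ((Finset.range (2 * d - 1)).filter fun i => σ i = σ (i + 1)).card + 2 ≤ d) :
    HyperedgesCross p (u '' {i | i < 2 * d ∧ σ i = true})
      (u '' {i | i < 2 * d ∧ σ i = false}) := by
  have huinj : ∀ i < 2 * d, ∀ j < 2 * d, u i = u j → i = j := by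
    intro i hi j hj hij
    rcases lt_trichotomy i j with h | h | h
    · exact absurd (congrArg t hij) (hu i j h hj).ne
    · exact h
    · exact absurd (congrArg t hij) (hu j i h hi).ne'
  refine ⟨?_, ?_⟩
  · rw [Set.disjoint_left]
    rintro _ ⟨i, ⟨hi, hi'⟩, rfl⟩ ⟨j, ⟨hj, hj'⟩, hij⟩
    rw [huinj j hj i hi hij, hi'] at hj'
    exact absurd hj' (by simp)
  obtain ⟨w, hw, hsum⟩ := exists_pos_weights_sum_eval_eq (m := 2 * d) (by omega)
    (s := fun i => t (u i)) hu σ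
  set K : Bool → Finset ℕ := fun b => (Finset.range (2 * d)).filter fun i => σ i = b with hK
  have hKlt : ∀ b, ∀ i ∈ K b, i < 2 * d := fun b i hi =>
    Finset.mem_range.1 (Finset.mem_filter.1 hi).1
  set W := ∑ i ∈ K true, w i with hW
  have hKW : ∀ b, ∑ i ∈ K b, w i = W := by
    have h := hsum 1 (by rw [Polynomial.natDegree_one]; omega)
    simp only [Polynomial.eval_one, mul_one] at h
    exact fun b => Bool.rec h.symm rfl b
  have hWpos : 0 < W := by
    rw [← hKW (σ 0)]
    refine Finset.sum_pos (fun i hi => hw i (hKlt _ i hi)) ⟨0, ?_⟩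
    exact Finset.mem_filter.2 ⟨Finset.mem_range.2 (by omega), rfl⟩
  have hmem : ∀ b, ∑ i ∈ K b, (w i / W) • p (u i) ∈
      intrinsicInterior ℝ (hyperedgeSimplex p (u '' {i | i < 2 * d ∧ σ i = b})) := by
    intro b
    have h := sum_smul_mem_intrinsicInterior_convexHull (K b) (fun i => p (u i))
      (fun i => w i / W)
      (fun i hi j hj hij => huinj i (hKlt b i hi) j (hKlt b j hj) (hinj hij))
      (fun i hi => div_pos (hw i (hKlt b i hi)) hWpos)
      (by rw [← Finset.sum_div, hKW b, div_self hWpos.ne'])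
    have hset : (K b : Set ℕ) = {i | i < 2 * d ∧ σ i = b} := by
      ext i
      simp [hK]
    rwa [hset, ← Function.comp_def p u, Set.image_comp] at h
  refine ⟨_, hmem true, ?_⟩
  have heq : ∑ i ∈ K true, (w i / W) • p (u i) = ∑ i ∈ K false, (w i / W) • p (u i) := by
    ext k
    have h := hsum (Polynomial.X ^ ((k : ℕ) + 1)) (by
      rw [Polynomial.natDegree_X_pow]
      omega)
    simp only [Polynomial.eval_pow, Polynomial.eval_X] at h
    simp only [WithLp.ofLp_sum, WithLp.ofLp_smul, Finset.sum_apply, Pi.smul_apply, smul_eq_mul, hp]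
    simp only [div_mul_eq_mul_div, ← Finset.sum_div]
    rw [h]
  rw [heq]
  exact hmem false

theorem exists_strictMono_enumeration {V : Type*} [Nonempty V] {t : V → ℝ}
    (ht : Function.Injective t) (S : Finset V) :
    ∃ u : ℕ → V, u '' {i | i < S.card} = (S : Set V) ∧
      ∀ i j, i < j → j < S.card → t (u i) < t (u j) := by
  let _ : LinearOrder V := LinearOrder.lift' t ht
  refine ⟨fun i => if h : i < S.card then S.orderEmbOfFin rfl ⟨i, h⟩ else Classical.arbitrary V,
    ?_, ?_⟩
  · rw [← S.range_orderEmbOfFin rfl]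
    ext v
    constructor
    · rintro ⟨i, hi, rfl⟩
      have hi : i < S.card := hi
      exact ⟨⟨i, hi⟩, by simp [hi]⟩
    · rintro ⟨i, rfl⟩
      exact ⟨i, i.2, by simp⟩
  · intro i j hij hj
    have hi : i < S.card := hij.trans hj
    simp only [hi, hj, dif_pos]
    exact (S.orderEmbOfFin rfl).strictMono (show (⟨i, hi⟩ : Fin S.card) < ⟨j, hj⟩ from hij)

/-- Every `2 * (m + 1)`-set of vertices and every word in `manyChangeWords m` give a crossing pair;
the pair determines the set as its union, and the word because the word starts with `true`. -/
theorem choose_mul_card_manyChangeWords_le {V : Type*} [Fintype V] {m : ℕ}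
    {p : V → EuclideanSpace ℝ (Fin (m + 1))} (hinj : Function.Injective p)
    (hp : ∀ v, p v ∈ momentCurve (m + 1)) :
    (Fintype.card V).choose (2 * (m + 1)) * (manyChangeWords m).card
      ≤ (crossingPairs (completeUniformHypergraph V (m + 1)) p).ncard := by
  classical
  rcases isEmpty_or_nonempty V with hV | hV
  · simp [Nat.choose_eq_zero_of_lt]
  choose t ht using hp
  have ht' : ∀ v, p v = WithLp.toLp 2 fun i : Fin (m + 1) => t v ^ ((i : ℕ) + 1) :=
    fun v => (ht v).symm
  have htinj : Function.Injective t := fun v w h => hinj (by rw [ht', ht', h])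
  choose u himg hu using exists_strictMono_enumeration htinj
  set A : Finset V → List Bool → Bool → Set V :=
    fun S l b => u S '' {i | i < S.card ∧ l.getD i false = b} with hA
  have huinj : ∀ S : Finset V, ∀ i < S.card, ∀ j < S.card, u S i = u S j → i = j := by
    intro S i hi j hj hij
    rcases lt_trichotomy i j with h | h | h
    · exact absurd (congrArg t hij) (hu S i j h hj).ne
    · exact h
    · exact absurd (congrArg t hij) (hu S j i h hi).ne'
  have hmemA : ∀ S l b, ∀ i < S.card, u S i ∈ A S l b ↔ l.getD i false = b := by
    intro S l b i hi
    constructor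
    · rintro ⟨j, ⟨hj, hj'⟩, hij⟩
      rwa [← huinj S j hj i hi hij]
    · exact fun h => ⟨i, ⟨hi, h⟩, rfl⟩
  have hunion : ∀ S l, A S l true ∪ A S l false = (S : Set V) := by
    intro S l
    rw [← himg S, hA, ← Set.image_union]
    congr 1
    ext i
    simp only [Set.mem_union, Set.mem_ofPred_eq]
    cases l.getD i false <;> simp
  set D := Finset.powersetCard (2 * (m + 1)) (Finset.univ : Finset V) ×ˢ manyChangeWords m with hD
  have hDcard : D.card = (Fintype.card V).choose (2 * (m + 1)) * (manyChangeWords m).card := by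
    rw [hD, Finset.card_product, Finset.card_powersetCard, Finset.card_univ]
  have hcardS : ∀ S l, (S, l) ∈ D → S.card = 2 * (m + 1) := by
    intro S l hSl
    rw [hD, Finset.mem_product] at hSl
    exact (Finset.mem_powersetCard.1 hSl.1).2
  have hfirst : ∀ S l, (S, l) ∈ D → u S 0 ∈ A S l true := by
    intro S l hSl
    have hS := hcardS S l hSl
    rw [hD, Finset.mem_product] at hSl
    obtain ⟨⟨t, rfl⟩, -⟩ := manyChangeWords_spec hSl.2
    rw [hmemA S _ true 0 (by omega)]
    simp
  have hword : ∀ S l l', (S, l) ∈ D → (S, l') ∈ D → A S l true = A S l' true → l = l' := by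
    intro S l l' h h' hAA
    rw [hD, Finset.mem_product, Finset.mem_powersetCard] at h h'
    have hlen := (manyChangeWords_spec h.2).2.1
    have hlen' := (manyChangeWords_spec h'.2).2.1
    refine List.ext_getElem (hlen.trans hlen'.symm) fun i hi hi' => ?_
    have hiS : i < S.card := by rw [h.1.2, ← hlen]; exact hi
    have hiff := hmemA S l true i hiS
    rw [hAA, hmemA S l' true i hiS, List.getD_eq_getElem _ _ hi, List.getD_eq_getElem _ _ hi']
      at hiff
    exact (Bool.eq_iff_iff.2 hiff).symm
  rw [← hDcard, ← Set.ncard_coe_finset]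
  refine Set.ncard_le_ncard_of_injOn (fun x => s(A x.1 x.2 true, A x.1 x.2 false)) ?_ ?_
    (Set.toFinite _)
  · rintro ⟨S, l⟩ hSl
    rw [Finset.mem_coe, hD, Finset.mem_product, Finset.mem_powersetCard] at hSl
    obtain ⟨⟨-, hS⟩, hl⟩ := hSl
    obtain ⟨-, hlen, hcount, hagree⟩ := manyChangeWords_spec hl
    have hedge : ∀ b, A S l b ∈ (completeUniformHypergraph V (m + 1)).edgeSet := by
      intro b
      have hcard := card_filter_getD_eq_count l b
      rw [hcount b, hlen] at hcard
      change (A S l b).encard = ((m + 1 : ℕ) : ℕ∞)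
      rw [hA, Set.InjOn.encard_image fun i hi j hj hij => huinj S i hi.1 j hj.1 hij, ← hcard,
        ← Set.encard_coe_eq_coe_finsetCard]
      congr 1
      ext i
      simp [hS]
    refine ⟨_, hedge true, _, hedge false, ?_, rfl⟩
    have := hyperedgesCross_of_card_agreements_le ht' hinj (u := u S)
      (σ := fun i => l.getD i false) (by rw [← hS]; exact hu S) (by
        rw [← hlen]
        exact Nat.succ_le_succ hagree)
    simp only [hA, hS]
    exact this
  · rintro ⟨S, l⟩ h ⟨S', l'⟩ h' heq
    rw [Finset.mem_coe] at h h'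
    have hSS : S = S' := by
      rw [← Finset.coe_inj, ← hunion S l, ← hunion S' l']
      rcases Sym2.eq_iff.1 heq with ⟨h1, h2⟩ | ⟨h1, h2⟩
      · exact congrArg₂ _ h1 h2
      · rw [Set.union_comm (A S' l' true)]
        exact congrArg₂ _ h1 h2
    subst hSS
    rcases Sym2.eq_iff.1 heq with ⟨h1, -⟩ | ⟨h1, -⟩
    · rw [hword S l l' h h' h1]
    · -- The smallest point lies in the first set of each pair, so the two sets cannot be swapped.
      have hS : 0 < S.card := by
        rw [hcardS S l h]
        omega
      have h3 := hfirst S l h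
      have h4 := hfirst S l' h'
      dsimp only at h1
      rw [h1, hmemA S l' false 0 hS] at h3
      rw [hmemA S l' true 0 hS, h3] at h4
      exact absurd h4 (by simp)

/-- Each pair of disjoint `d`-sets is determined by its union and one of the two sets. -/
theorem ncard_crossingPairs_le {V : Type*} [Fintype V] {d : ℕ}
    (p : V → EuclideanSpace ℝ (Fin d)) :
    (crossingPairs (completeUniformHypergraph V d) p).ncard
      ≤ (Fintype.card V).choose (2 * d) * d.centralBinom := by
  classical
  set D := (Finset.powersetCard (2 * d) (Finset.univ : Finset V)).sigma
    fun S => Finset.powersetCard d S with hD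
  have hDcard : D.card = (Fintype.card V).choose (2 * d) * d.centralBinom := by
    rw [hD, Finset.card_sigma, Finset.sum_congr rfl fun S hS => by
      rw [Finset.card_powersetCard, (Finset.mem_powersetCard.1 hS).2], Finset.sum_const,
      Finset.card_powersetCard, Finset.card_univ, smul_eq_mul, Nat.centralBinom_eq_two_mul_choose]
  rw [← hDcard]
  refine le_trans (Set.ncard_le_ncard (t := ((D.image fun x =>
    s((x.2 : Set V), ((x.1 \ x.2 : Finset V) : Set V)) : Finset (Sym2 (Set V))) :
      Set (Sym2 (Set V)))) ?_ (Finset.finite_toSet _)) ?_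
  · rintro _ ⟨e, he, f, hf, ⟨hef, -⟩, rfl⟩
    have he : e.encard = d := he
    have hf : f.encard = d := hf
    lift e to Finset V using Set.toFinite e
    lift f to Finset V using Set.toFinite f
    rw [Set.encard_coe_eq_coe_finsetCard, Nat.cast_inj] at he hf
    rw [Finset.disjoint_coe] at hef
    refine Finset.mem_coe.2 (Finset.mem_image.2 ⟨⟨e ∪ f, e⟩, ?_, ?_⟩)
    · rw [hD, Finset.mem_sigma, Finset.mem_powersetCard, Finset.mem_powersetCard]
      refine ⟨⟨Finset.subset_univ _, ?_⟩, Finset.subset_union_left, he⟩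
      rw [Finset.card_union_of_disjoint hef, he, hf, two_mul]
    · dsimp only
      rw [Finset.union_sdiff_cancel_left hef]
  · rw [Set.ncard_coe_finset]
    exact Finset.card_image_le

theorem mainTheorem4 :
    ∃ c C : ℝ, 0 < c ∧ 0 < C ∧
      ∀ d : ℕ, 2 ≤ d → ∀ (n : ℕ) (p : Fin n → EuclideanSpace ℝ (Fin d)),
        Function.Injective p → (∀ v, p v ∈ momentCurve d) →
          c * ((4 : ℝ) ^ d / √(d : ℝ)) * (n.choose (2 * d) : ℝ) ≤
              ((crossingPairs (completeUniformHypergraph (Fin n) d) p).ncard : ℝ) ∧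
            ((crossingPairs (completeUniformHypergraph (Fin n) d) p).ncard : ℝ) ≤
              C * ((4 : ℝ) ^ d / √(d : ℝ)) * (n.choose (2 * d) : ℝ) := by
  -- `48 = 8 * 6`: one factor from Wallis-type bounds, the other from cutting the sum of squares.
  refine ⟨1 / 48, 1, by norm_num, one_pos, fun d hd n p hinj hp => ⟨?_, ?_⟩⟩
  · obtain ⟨m, rfl⟩ : ∃ m, d = m + 1 := ⟨d - 1, by omega⟩
    have hm : 1 ≤ m := by omega
    have h1 := four_pow_div_sqrt_le_centralBinom hm
    have h2 : (m.centralBinom : ℝ) ≤ 6 * (manyChangeWords m).card := by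
      rw [card_manyChangeWords]
      exact_mod_cast centralBinom_le_six_mul_sum_choose_sq hm
    have h3 := choose_mul_card_manyChangeWords_le hinj hp
    rw [Fintype.card_fin] at h3
    have h3' : (n.choose (2 * (m + 1)) : ℝ) * (manyChangeWords m).card ≤
        ((crossingPairs (completeUniformHypergraph (Fin n) (m + 1)) p).ncard : ℝ) := by
      exact_mod_cast h3
    refine le_trans ?_ h3'
    rw [mul_comm]
    exact mul_le_mul_of_nonneg_left (by linarith) (Nat.cast_nonneg _)
  · have h1 := ncard_crossingPairs_le p
    rw [Fintype.card_fin] at h1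
    have h1' : ((crossingPairs (completeUniformHypergraph (Fin n) d) p).ncard : ℝ) ≤
        n.choose (2 * d) * d.centralBinom := by
      exact_mod_cast h1
    refine h1'.trans ?_
    rw [one_mul, mul_comm]
    exact mul_le_mul_of_nonneg_right (centralBinom_le_four_pow_div_sqrt (by omega))
      (Nat.cast_nonneg _)
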